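/- **Setting.** Manifolds are smooth, Hausdorff, second countable, finite-dimensional and without boundary. Let $M$ be a manifold of dimension $n$. A *stratified subset* $(C,\mathcal S)$ of $M$ is a closed subset $C\subset M$ with a locally finite decomposition $\mathcal S$ into disjoint non-empty embedded submanifolds of $M$ (strata, each of a fixed dimension) such that $X\cap\overline Y\neq\emptyset$ implies $X\subset\overline Y$ for $X,Y\in\mathcal S$. Write $X\le Y$ if $X\subset\overline Y$, and $X<Y$ if moreover $X\ne Y$. Put $M_d=M\setminus\bigcup_{\dim X<d}X$. A *collection of tubular neighbourhoods* for $\mathcal S$ consists, for each stratum $X$ (with $d=\dim X$ and normal bundle $\nu_X$ in $M_d$), of the following data. * A smooth complete vector field $V_X$ on $M_d$ that is Euler-like along $X$: it is tangent to $X$, and for every smooth $f$ on $M_d$ vanishing on $X$ the function $f-\mathcal L_{V_X}f$ vanishes to order $2$ on $X$. * The complete tubular neighbourhood embedding $\Phi_X:\nu_X\to M_d$ induced by $V_X$: a diffeomorphism onto an open set $T_X=\Phi_X(\nu_X)$ that is the identity on the zero section $X$, has the identity of $\nu_X$ as linear approximation, and relates the Euler vector field of $\nu_X$ (with flow the multiplication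 by $e^t$) to $V_X$. Let $m_X^t:T_X\to T_X$, $t\ge 0$, be the fibrewise multiplication by $t$ transported by $\Phi_X$. * A smooth function $\rho_X:T_X\to\mathbb R_{\ge0}$ with $\rho_X^{-1}(0)=X$ and $\rho_X\circ m_X^t=t^2\rho_X$. $V_X$ is required to be *convenient*: $m_X^0:T_X\to X$ extends to a smooth map to $X$ on an open neighbourhood of the closure of $T_X$ in $M_d$, and $\{V_X\ne0\}$ is the set of points of $M_d\setminus X$ whose flow line under $V_X$ converges to a point of $X$ as $t\to-\infty$. The collection is *commutative tangential control data* if the following hold. 1. (Adjusted) $T_X\cap T_Y\neq\emptyset$ if and only if $X\le Y$ or $Y\le X$; $T_X\cap Y\ne\emptyset$ if and only if $X\le Y$; $\overline{T_X}\cap\overline{T_Y}\cap M_d=\emptyset$ for $X\ne Y$ of the same dimension $d$; $\rho_X^{-1}([0,a])$ is closed in $M_{\dim X}$ for all $a\ge 0$. 2. (Local finiteness) For each $d$ the family $\{T_X\}_{\dim X=d}$ is locally finite in $M_d$. 3. (Tangential) If $X<Y$, then $V_X(y)\in T_yY$ for $y\in Y\cap T_X$. 4. (Pre-commutative) If $X<Y$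 and $t\ge0$, then $m_X^0\circ m_Y^t=m_X^0$ and $\rho_X\circ m_Y^t=\rho_X$ on the common domain of definition of both sides. 5. (Commutative) If $X<Y$, $s>0$ and $t\ge0$, then $m_X^s\circ m_Y^t=m_Y^t\circ m_X^s$ and $\rho_Y\circ m_X^s=\rho_Y$ on the common domain of definition of both sides. **Theorem.** Let $(C,\mathcal S)$ be a stratified subset of $M$ with commutative tangential control data $\{(V_X,T_X,m_X^t,\rho_X)\}_{X\in\mathcal S}$, and let $U=\bigcup_{X\in\mathcal S}\{x\in T_X:\rho_X(x)<1\}$. Then $U$ is an open set containing $C$, and there is a smooth homotopy $F:M\times[0,1]\to M$ that restricts to a smooth weak deformation retraction of $U$ to $C$, i.e. $F(U\times[0,1])\subset U$, $F(x,0)=x$ and $F(x,1)\in C$ for all $x\in U$, and $F(C\times[0,1])\subset C$. If moreover a compact Lie group $G$ acts smoothly on $M$, every stratum is $G$-invariant, and all $V_X$ and $\rho_X$ are $G$-invariant, then $F$ can be chosen $G$-equivariant: $F(gx,t)=gF(x,t)$ for all $g\in G$, $x\in M$, $t\in[0,1]$. -/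

import Mathlib

open Set Filter Topology
open scoped Manifold ContDiff

universe u w

noncomputable section

namespace StratControl

section Submanifolds

variable {n : ℕ} {M : Type u} [TopologicalSpace M] [ChartedSpace (EuclideanSpace ℝ (Fin n)) M]
  [IsManifold (𝓡 n) ∞ M]

/-- `N` is an embedded `k`-dimensional submanifold of the `n`-manifold `M`: around each of its
points there is a smooth chart of `M` in which `N` is the slice on which the coordinates with
index `≥ k` vanish. -/
def IsEmbeddedSubmanifold (n : ℕ) {M : Type u} [TopologicalSpace M]
    [ChartedSpace (EuclideanSpace ℝ (Fin n)) M] (k : ℕ) (N : Set M) : Prop :=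
  k ≤ n ∧ ∀ p ∈ N, ∃ e ∈ IsManifold.maximalAtlas (𝓡 n) ∞ M, p ∈ e.source ∧
    ∀ x ∈ e.source, (x ∈ N ↔ ∀ i : Fin n, k ≤ (i : ℕ) → e x i = 0)

/-- The curve `γ` passes through `p` at time `0`, with velocity `v`. (All tangent spaces of `M` are
copies of the model space, so that `v` may be read in the tangent space at `γ 0 = p`.) -/
def HasVelocity (γ : ℝ → M) (p : M) (v : TangentSpace (𝓡 n) p) : Prop :=
  γ 0 = p ∧ HasMFDerivAt 𝓘(ℝ, ℝ) (𝓡 n) γ 0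
    ((1 : ℝ →L[ℝ] ℝ).smulRight (show EuclideanSpace ℝ (Fin n) from v))

/-- The tangent space `T_p N`, as a subspace of `T_p M`: it is spanned by the velocities at `p` of
the smooth curves of `M` through `p` that run in `N`. (For an embedded submanifold these
velocities already form a linear subspace.) -/
def tangentSpaceOf (N : Set M) (p : M) : Submodule ℝ (TangentSpace (𝓡 n) p) :=
  Submodule.span ℝ {v | ∃ γ : ℝ → M, HasVelocity γ p v ∧ ∃ ε > 0,
    ContMDiffOn 𝓘(ℝ, ℝ) (𝓡 n) ∞ γ (Ioo (-ε) ε) ∧ ∀ t ∈ Ioo (-ε) ε, γ t ∈ N}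

/-- The total space of the normal bundle `ν(M, N) = TM|_N / TN`. -/
def NormalBundle (n : ℕ) {M : Type u} [TopologicalSpace M]
    [ChartedSpace (EuclideanSpace ℝ (Fin n)) M] (N : Set M) : Type u :=
  Σ p : N, TangentSpace (𝓡 n) (p : M) ⧸ tangentSpaceOf N (p : M)

namespace NormalBundle

/-- The class in the normal bundle of a tangent vector of `M` whose base point is in `N`. -/
def mk {N : Set M} (v : TangentBundle (𝓡 n) M) (h : v.proj ∈ N) : NormalBundle n N :=
  ⟨⟨v.proj, h⟩, Submodule.Quotient.mk v.snd⟩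

/-- The zero section. -/
def zero {N : Set M} (p : N) : NormalBundle n N := ⟨p, 0⟩

/-- Fibrewise multiplication by scalars in the normal bundle. -/
def scale {N : Set M} (t : ℝ) (w : NormalBundle n N) : NormalBundle n N := ⟨w.1, t • w.2⟩

/-- Smoothness of a map out of the normal bundle of an embedded submanifold. The projection
`TM|_N → ν(M, N)` is a surjective submersion and `TM|_N` is an embedded submanifold of `TM`, so `f`
is smooth if and only if its pullback to `TM|_N` is smooth. -/
def IsSmooth {E' H' M' : Type*} [NormedAddCommGroup E'] [NormedSpace ℝ E'] [TopologicalSpace H']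
    (I' : ModelWithCorners ℝ E' H') [TopologicalSpace M'] [ChartedSpace H' M']
    {N : Set M} (f : NormalBundle n N → M') : Prop :=
  ∃ g : TangentBundle (𝓡 n) M → M',
    ContMDiffOn (𝓡 n).tangent I' ∞ g {v | v.proj ∈ N} ∧
    ∀ (v : TangentBundle (𝓡 n) M) (h : v.proj ∈ N), g v = f (mk v h)

end NormalBundle

/-- `Φ : ν(M, N) → M` is a complete tubular neighbourhood embedding of `N` in the open subset `U`
of `M`. -/
structure IsCompleteTubularEmbedding (N U : Set M) (Φ : NormalBundle n N → M) : Prop where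
  smooth : NormalBundle.IsSmooth (𝓡 n) Φ
  injective : Function.Injective Φ
  mem : ∀ w, Φ w ∈ U
  /-- The image is open and the inverse is smooth: locally on the image, the inverse has a smooth
  lift to `TM|_N`. -/
  smooth_inverse : ∀ x ∈ range Φ, ∃ W : Set M, IsOpen W ∧ x ∈ W ∧
    ∃ σ : M → TangentBundle (𝓡 n) M, ContMDiffOn (𝓡 n) (𝓡 n).tangent ∞ σ W ∧
      ∀ y ∈ W, ∃ h : (σ y).proj ∈ N, Φ (NormalBundle.mk (σ y) h) = y
  zero : ∀ p : N, Φ (NormalBundle.zero p) = p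
  /-- The linear approximation `ν(Φ)` is the identity: the derivative of `t ↦ Φ (t • [v])` at
  `t = 0` is congruent to `v` modulo `T_p N`. -/
  normal_derivative : ∀ (p : M) (h : p ∈ N) (v : TangentSpace (𝓡 n) p),
    ∃ u : TangentSpace (𝓡 n) p, u - v ∈ tangentSpaceOf N p ∧
      HasVelocity
        (fun t : ℝ => Φ (NormalBundle.mk (⟨p, t • v⟩ : TangentBundle (𝓡 n) M) h)) p u

/-- The Lie derivative of a real function along a vector field. -/
def lieDeriv (V : (x : M) → TangentSpace (𝓡 n) x) (f : M → ℝ) (x : M) : ℝ :=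
  mfderiv (𝓡 n) 𝓘(ℝ, ℝ) f x (V x)

/-- The vector field `V` on the open set `U` is Euler-like along `N ⊆ U`: it is smooth and tangent
to `N`, and for each smooth function `f` on `U` that vanishes on `N` the function `f - L_V f`
vanishes to order two on `N`. -/
structure IsEulerLike (N U : Set M) (V : (x : M) → TangentSpace (𝓡 n) x) : Prop where
  smooth : ContMDiffOn (𝓡 n) (𝓡 n).tangent ∞ (fun x => (⟨x, V x⟩ : TangentBundle (𝓡 n) M)) U
  tangent : ∀ p ∈ N, V p ∈ tangentSpaceOf N p
  order_two : ∀ f : M → ℝ, ContMDiffOn (𝓡 n) 𝓘(ℝ, ℝ) ∞ f U → (∀ p ∈ N, f p = 0) →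
    ∀ p ∈ N, f p - lieDeriv V f p = 0 ∧
      mfderiv (𝓡 n) 𝓘(ℝ, ℝ) (fun x => f x - lieDeriv V f x) p = 0

/-- A smooth function `ν(M, N) → ℝ_{≥ 0}` that vanishes exactly on the zero section and is
homogeneous of degree two on the fibres. -/
structure IsDistanceFunction (N : Set M) (r : NormalBundle n N → ℝ) : Prop where
  smooth : NormalBundle.IsSmooth 𝓘(ℝ, ℝ) r
  nonneg : ∀ w, 0 ≤ r w
  eq_zero_iff : ∀ w, r w = 0 ↔ ∃ p : N, w = NormalBundle.zero p
  homogeneous : ∀ (t : ℝ), 0 ≤ t → ∀ w, r (NormalBundle.scale t w) = t ^ 2 * r w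

/-- A convenient tubular neighbourhood with distance of `N` in the open subset `U` of `M`. All
maps are total functions on `M`: the values of `V` outside `U` and those of `m` and `ρ` outside
the tube `T = range Φ` are irrelevant. -/
structure ConvenientTube (n : ℕ) {M : Type u} [TopologicalSpace M]
    [ChartedSpace (EuclideanSpace ℝ (Fin n)) M] [IsManifold (𝓡 n) ∞ M] (N U : Set M) where
  /-- The Euler-like vector field. -/
  V : (x : M) → TangentSpace (𝓡 n) x
  /-- The tubular neighbourhood embedding. -/
  Φ : NormalBundle n N → M
  /-- The multiplication by scalars on the tube. -/
  m : ℝ → M → M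
  /-- The distance function on the tube. -/
  ρ : M → ℝ
  eulerLike : IsEulerLike N U V
  /-- `V` is complete on `U`. -/
  complete : ∀ p ∈ U, ∃ γ : ℝ → M, γ 0 = p ∧ (∀ t, γ t ∈ U) ∧ IsMIntegralCurve (I := 𝓡 n) γ V
  embedding : IsCompleteTubularEmbedding N U Φ
  /-- `Φ` is induced by `V`: the Euler vector field of the normal bundle, whose flow is the
  multiplication by `exp t`, is `Φ`-related to `V`. -/
  related : ∀ w, IsMIntegralCurve (I := 𝓡 n) (fun t => Φ (NormalBundle.scale (Real.exp t) w)) V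
  m_spec : ∀ t : ℝ, 0 ≤ t → ∀ w, m t (Φ w) = Φ (NormalBundle.scale t w)
  ρ_spec : IsDistanceFunction N (fun w => ρ (Φ w))
  /-- The projection of the tube to `N` extends smoothly to a neighbourhood of the closure of the
  tube in `U`. -/
  extendable : ∃ W : Set M, IsOpen W ∧ W ⊆ U ∧ closure (range Φ) ∩ U ⊆ W ∧
    ∃ π : M → M, ContMDiffOn (𝓡 n) (𝓡 n) ∞ π W ∧ MapsTo π W N ∧ ∀ x ∈ range Φ, π x = m 0 x
  /-- `V` is non-zero exactly at the points off `N` whose backward flow converges to a point of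
  `N`. -/
  conical : {p | p ∈ U ∧ V p ≠ 0} = {p | p ∈ U ∧ p ∉ N ∧ ∃ γ : ℝ → M, γ 0 = p ∧
    (∀ t, γ t ∈ U) ∧ IsMIntegralCurve (I := 𝓡 n) γ V ∧ ∃ q ∈ N, Tendsto γ atBot (𝓝 q)}

/-- The tube `T ⊆ U`. -/
def ConvenientTube.T {N U : Set M} (τ : ConvenientTube n N U) : Set M := range τ.Φ

/-- The open tube `{ρ < a}`. -/
def ConvenientTube.sublevel {N U : Set M} (τ : ConvenientTube n N U) (a : ℝ) : Set M :=
  {x | x ∈ τ.T ∧ τ.ρ x < a}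

end Submanifolds

section Stratifications

/-- A stratified subset `(C, 𝒮)` of the `n`-manifold `M`, with `C` closed: a locally finite
decomposition of `C` into non-empty embedded submanifolds of `M` that satisfies the condition of
the frontier. -/
structure StratifiedSubset (n : ℕ) (M : Type u) [TopologicalSpace M]
    [ChartedSpace (EuclideanSpace ℝ (Fin n)) M] where
  /-- The set `C`. -/
  carrier : Set M
  /-- The set `𝒮` of strata. -/
  strata : Set (Set M)
  /-- The dimensions of the strata. -/
  dim : strata → ℕ
  isClosed_carrier : IsClosed carrier
  sUnion_strata : ⋃₀ strata = carrier
  nonempty : ∀ X ∈ strata, X.Nonempty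
  disjoint : ∀ X ∈ strata, ∀ Y ∈ strata, X ≠ Y → Disjoint X Y
  locallyFinite : LocallyFinite (fun X : strata => (X : Set M))
  submanifold : ∀ X : strata, IsEmbeddedSubmanifold n (dim X) (X : Set M)
  frontier : ∀ X ∈ strata, ∀ Y ∈ strata, (X ∩ closure Y).Nonempty → X ⊆ closure Y

variable {n : ℕ} {M : Type u} [TopologicalSpace M] [ChartedSpace (EuclideanSpace ℝ (Fin n)) M]
  [IsManifold (𝓡 n) ∞ M]

namespace StratifiedSubset

/-- The order relation of strata, `X ⊆ closure Y`. -/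
def le (S : StratifiedSubset n M) (X Y : S.strata) : Prop := (X : Set M) ⊆ closure (Y : Set M)

/-- The strict order relation of strata. -/
def lt (S : StratifiedSubset n M) (X Y : S.strata) : Prop := S.le X Y ∧ X ≠ Y

/-- The set `M_d`, the complement in `M` of the union of the strata of dimension `< d`. -/
def upper (S : StratifiedSubset n M) (d : ℕ) : Set M :=
  {x | ∀ X : S.strata, S.dim X < d → x ∉ (X : Set M)}

end StratifiedSubset

/-- A collection of tubular neighbourhoods for `𝒮`: a convenient tubular neighbourhood with
distance of each stratum `X` in `M_d`, where `d = dim X`. -/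
abbrev TubeCollection (S : StratifiedSubset n M) : Type u :=
  ∀ X : S.strata, ConvenientTube n (X : Set M) (S.upper (S.dim X))

namespace TubeCollection

variable {S : StratifiedSubset n M}

/-- The collection is adjusted to the stratification. -/
structure IsAdjusted (τ : TubeCollection S) : Prop where
  inter_tubes : ∀ X Y, ((τ X).T ∩ (τ Y).T).Nonempty ↔ (S.le X Y ∨ S.le Y X)
  inter_strata : ∀ X Y : S.strata, ((τ X).T ∩ (Y : Set M)).Nonempty ↔ S.le X Y
  same_dim : ∀ X Y, X ≠ Y → S.dim X = S.dim Y →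
    closure (τ X).T ∩ closure (τ Y).T ∩ S.upper (S.dim X) = ∅
  closed_sublevel : ∀ (X : S.strata) (a : ℝ), 0 ≤ a →
    IsClosed ((↑) ⁻¹' {x | x ∈ (τ X).T ∧ (τ X).ρ x ≤ a} : Set (S.upper (S.dim X)))

/-- For each `d`, the tubes of the strata of dimension `d` are locally finite in `M_d`. -/
def IsLocallyFinite (τ : TubeCollection S) : Prop :=
  ∀ d : ℕ, ∀ x ∈ S.upper d, ∃ W ∈ 𝓝 x, {X | S.dim X = d ∧ ((τ X).T ∩ W).Nonempty}.Finite

/-- The vector field of each stratum is tangent to the higher strata. -/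
def IsTangential (τ : TubeCollection S) : Prop :=
  ∀ X Y : S.strata, S.lt X Y → ∀ y ∈ (Y : Set M) ∩ (τ X).T, (τ X).V y ∈ tangentSpaceOf (Y : Set M) y

/-- `m_X^0 ∘ m_Y^t = m_X^0` and `ρ_X ∘ m_Y^t = ρ_X` for `X < Y` and `t ≥ 0`, in the domain of
definition of both sides. -/
def IsPreCommutative (τ : TubeCollection S) : Prop :=
  ∀ X Y, S.lt X Y → ∀ t : ℝ, 0 ≤ t → ∀ v ∈ (τ X).T ∩ (τ Y).T, (τ Y).m t v ∈ (τ X).T →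
    (τ X).m 0 ((τ Y).m t v) = (τ X).m 0 v ∧ (τ X).ρ ((τ Y).m t v) = (τ X).ρ v

/-- `m_X^s ∘ m_Y^t = m_Y^t ∘ m_X^s` and `ρ_Y ∘ m_X^s = ρ_Y` for `X < Y`, `s > 0` and `t ≥ 0`, in the
domain of definition of both sides. -/
def IsCommutative (τ : TubeCollection S) : Prop :=
  ∀ X Y, S.lt X Y → ∀ s : ℝ, 0 < s → ∀ v ∈ (τ X).T ∩ (τ Y).T, (τ X).m s v ∈ (τ Y).T →
    (∀ t : ℝ, 0 ≤ t → (τ Y).m t v ∈ (τ X).T →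
      (τ X).m s ((τ Y).m t v) = (τ Y).m t ((τ X).m s v)) ∧
    (τ Y).ρ ((τ X).m s v) = (τ Y).ρ v

/-- Commutative tangential control data. -/
structure IsCommutativeTangentialControlData (τ : TubeCollection S) : Prop where
  adjusted : τ.IsAdjusted
  locallyFinite : τ.IsLocallyFinite
  tangential : τ.IsTangential
  preCommutative : τ.IsPreCommutative
  commutative : τ.IsCommutative

/-- The data are invariant under the action of `G` on `M`: the vector fields `V_X` and the
functions `ρ_X` are `G`-invariant. -/
structure IsEquivariant (G : Type w) [Group G] [MulAction G M] (τ : TubeCollection S) : Prop where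
  vectorField : ∀ X, ∀ g : G, ∀ x ∈ S.upper (S.dim X),
    mfderiv (𝓡 n) (𝓡 n) (fun y : M => g • y) x ((τ X).V x) = (τ X).V (g • x)
  distance : ∀ X, ∀ g : G, ∀ x ∈ (τ X).T, (τ X).ρ (g • x) = (τ X).ρ x

/-- The open set `⋃_X {ρ_X < 1}`. -/
def neighbourhood (τ : TubeCollection S) : Set M := ⋃ X, (τ X).sublevel 1

end TubeCollection

/-- Each stratum is `G`-invariant. -/
def IsGStratification (G : Type w) [Group G] [MulAction G M] (S : StratifiedSubset n M) : Prop :=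
  ∀ X ∈ S.strata, ∀ g : G, ∀ x ∈ X, g • x ∈ X

/-- The smooth homotopy `F : M × [0,1] → M` restricts to a smooth weak deformation retraction of the
open set `U ⊆ M` onto `C ⊆ U`: it restricts to a homotopy `U × [0,1] → U` that starts at the
identity, ends in a map of `U` into `C`, and preserves `C` at all times. -/
structure RestrictsToWeakDeformationRetraction (F : M × unitInterval → M) (U C : Set M) :
    Prop where
  smooth : ContMDiff ((𝓡 n).prod (𝓡∂ 1)) (𝓡 n) ∞ F
  isOpen : IsOpen U
  subset : C ⊆ U
  mapsTo : ∀ x ∈ U, ∀ t, F (x, t) ∈ U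
  at_zero : ∀ x ∈ U, F (x, 0) = x
  at_one : ∀ x ∈ U, F (x, 1) ∈ C
  preserves : ∀ x ∈ C, ∀ t, F (x, t) ∈ C

end Stratifications

end StratControl

end

/-! Tubes of equal dimension are disjoint, so for each `d` the tubes of the `d`-dimensional strata
carry one multiplication `mul d` and one distance `dist d`. The homotopy shrinks them by the factor
`1 - t * weight d`, the highest dimension acting first. The weight is 1 where `dist d ≤ 1` and no
lower distance is below 1. It vanishes near the lower strata, where the tubes of dimension `d` are
not controlled; this makes each `step` smooth on all of `M`.

The control conditions hold only on common domains, so orbits of one multiplication must be kept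
inside the other tubes. The parameters `s > 0` for which the orbit stays in a tube form an open set.
This set is also closed, because the distance is constant along it and closed tubes are closed in
`upper`. The lemmas `m_mem_stratum`, `m_mem_higher` and `m_mem_lower` rest on this argument.

Hence a factor in `[0, 1]` never increases the least available distance (`exists_dist_mul_le`).
Since `C` is the locus where some distance is `≤ 0` and `U` the locus where some distance is `< 1`,
both are preserved. For a point of `U`, take the lowest `e` with distance below 1. Higher steps keep
this distance, and, unless a still lower tube has been entered meanwhile, step `e` has factor 0 at
time 1 and lands in a stratum; later steps stay in `C` (`homotopy_one_mem_carrier`). All ingredients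
are built from `V` and `ρ`, which gives equivariance. -/

namespace StratControl

/-! ### Scalar multiplication in the normal bundle -/

section NormalBundle

variable {n : ℕ} {M : Type u} [TopologicalSpace M] [ChartedSpace (EuclideanSpace ℝ (Fin n)) M]
  {N : Set M}

namespace NormalBundle

theorem scale_one (w : NormalBundle n N) : scale 1 w = w :=
  congrArg (Sigma.mk w.1) (one_smul ℝ w.2)

theorem scale_scale (s t : ℝ) (w : NormalBundle n N) : scale s (scale t w) = scale (s * t) w :=
  congrArg (Sigma.mk w.1) (mul_smul s t w.2).symm

theorem scale_zero (w : NormalBundle n N) : scale 0 w = zero w.1 :=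
  congrArg (Sigma.mk w.1) (zero_smul ℝ w.2)

theorem scale_zero_section (t : ℝ) (p : N) : scale t (zero (n := n) p) = zero p :=
  congrArg (Sigma.mk p) (smul_zero t)

theorem scale_mk (t : ℝ) (v : TangentBundle (𝓡 n) M) (h : v.proj ∈ N) :
    scale t (mk v h) = mk (⟨v.proj, t • v.snd⟩ : TangentBundle (𝓡 n) M) h := rfl

end NormalBundle

end NormalBundle

/-! ### Calculus on a single tube -/

section Tubes

variable {n : ℕ} {M : Type u} [TopologicalSpace M] [ChartedSpace (EuclideanSpace ℝ (Fin n)) M]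
  [IsManifold (𝓡 n) ∞ M]

/-- Scalar multiplication of a smooth map into the tangent bundle by a smooth function. -/
theorem contMDiffOn_smul_tangentBundle {E' H' M' : Type*} [NormedAddCommGroup E'] [NormedSpace ℝ E']
    [TopologicalSpace H'] {I' : ModelWithCorners ℝ E' H'} [TopologicalSpace M'] [ChartedSpace H' M']
    {f : M' → ℝ} {σ : M' → TangentBundle (𝓡 n) M} {s : Set M'}
    (hf : ContMDiffOn I' 𝓘(ℝ, ℝ) ∞ f s) (hσ : ContMDiffOn I' (𝓡 n).tangent ∞ σ s) :
    ContMDiffOn I' (𝓡 n).tangent ∞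
      (fun y => (⟨(σ y).proj, f y • (σ y).snd⟩ : TangentBundle (𝓡 n) M)) s := by
  intro x hx
  have h := (Bundle.contMDiffWithinAt_totalSpace (IB := 𝓡 n)).1 (hσ x hx)
  refine (Bundle.contMDiffWithinAt_totalSpace (IB := 𝓡 n)).2 ⟨h.1, ?_⟩
  refine ((hf x hx).smul h.2).congr_of_eventuallyEq ?_ ?_
  · have hb : ∀ᶠ y in 𝓝[s] x, (σ y).proj ∈ (trivializationAt (EuclideanSpace ℝ (Fin n))
        (TangentSpace (𝓡 n)) (σ x).proj).baseSet :=
      h.1.continuousWithinAt.preimage_mem_nhdsWithin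
        ((trivializationAt (EuclideanSpace ℝ (Fin n)) (TangentSpace (𝓡 n))
          (σ x).proj).open_baseSet.mem_nhds (FiberBundle.mem_baseSet_trivializationAt' _))
    filter_upwards [hb] with y hy
    exact ((trivializationAt (EuclideanSpace ℝ (Fin n)) (TangentSpace (𝓡 n))
      (σ x).proj).linear ℝ hy).map_smul (f y) (σ y).snd
  · exact ((trivializationAt (EuclideanSpace ℝ (Fin n)) (TangentSpace (𝓡 n))
      (σ x).proj).linear ℝ (FiberBundle.mem_baseSet_trivializationAt' _)).map_smul (f x) (σ x).snd

/-- Integral curves that stay in an open set on which the vector field is smooth are determined by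
one value. -/
theorem integralCurve_unique [T2Space M] {U : Set M} (hU : IsOpen U)
    {V : (x : M) → TangentSpace (𝓡 n) x}
    (hV : ContMDiffOn (𝓡 n) (𝓡 n).tangent ∞ (fun x => (⟨x, V x⟩ : TangentBundle (𝓡 n) M)) U)
    {γ γ' : ℝ → M} (hγ : IsMIntegralCurve (I := 𝓡 n) γ V) (hγ' : IsMIntegralCurve (I := 𝓡 n) γ' V)
    (hγU : ∀ t, γ t ∈ U) {t₀ : ℝ} (h₀ : γ t₀ = γ' t₀) : γ = γ' := by
  have hc : Continuous γ := continuous_iff_continuousAt.2 fun t => (hγ t).continuousAt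
  have hc' : Continuous γ' := continuous_iff_continuousAt.2 fun t => (hγ' t).continuousAt
  -- Only `γ` is known to stay in `U`; this suffices, since local uniqueness is applied at points
  -- where the curves agree.
  have hclopen : IsClopen {t | γ t = γ' t} := by
    refine ⟨isClosed_eq hc hc', isOpen_iff_mem_nhds.2 fun t ht => ?_⟩
    exact isMIntegralCurveAt_eventuallyEq_of_contMDiffAt_boundaryless
      (((hV _ (hγU t)).contMDiffAt (hU.mem_nhds (hγU t))).of_le (by simp))
      (hγ.isMIntegralCurveAt t) (hγ'.isMIntegralCurveAt t) ht
  have huniv := hclopen.eq_univ ⟨t₀, h₀⟩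
  funext t
  exact huniv.ge (mem_univ t)

namespace ConvenientTube

variable {N U : Set M} (τ : ConvenientTube n N U)

theorem subset_T (τ : ConvenientTube n N U) : N ⊆ τ.T := fun p hp => ⟨_, τ.embedding.zero ⟨p, hp⟩⟩

theorem T_subset : τ.T ⊆ U := by
  rintro _ ⟨w, rfl⟩
  exact τ.embedding.mem w

theorem m_mem {t : ℝ} (ht : 0 ≤ t) {x : M} (hx : x ∈ τ.T) : τ.m t x ∈ τ.T := by
  obtain ⟨w, rfl⟩ := hx
  exact ⟨_, (τ.m_spec t ht w).symm⟩

theorem m_one {x : M} (hx : x ∈ τ.T) : τ.m 1 x = x := by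
  obtain ⟨w, rfl⟩ := hx
  rw [τ.m_spec 1 zero_le_one, NormalBundle.scale_one]

theorem m_m {s t : ℝ} (hs : 0 ≤ s) (ht : 0 ≤ t) {x : M} (hx : x ∈ τ.T) :
    τ.m s (τ.m t x) = τ.m (s * t) x := by
  obtain ⟨w, rfl⟩ := hx
  rw [τ.m_spec t ht, τ.m_spec s hs, τ.m_spec _ (mul_nonneg hs ht), NormalBundle.scale_scale]

theorem m_zero_mem {x : M} (hx : x ∈ τ.T) : τ.m 0 x ∈ N := by
  obtain ⟨w, rfl⟩ := hx
  rw [τ.m_spec 0 le_rfl, NormalBundle.scale_zero, τ.embedding.zero]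
  exact w.1.2

theorem m_of_mem {t : ℝ} (ht : 0 ≤ t) {x : M} (hx : x ∈ N) : τ.m t x = x := by
  have h := τ.m_spec t ht (NormalBundle.zero ⟨x, hx⟩)
  rwa [NormalBundle.scale_zero_section, τ.embedding.zero] at h

theorem ρ_nonneg {x : M} (hx : x ∈ τ.T) : 0 ≤ τ.ρ x := by
  obtain ⟨w, rfl⟩ := hx
  exact τ.ρ_spec.nonneg w

theorem ρ_eq_zero_iff {x : M} (hx : x ∈ τ.T) : τ.ρ x = 0 ↔ x ∈ N := by
  obtain ⟨w, rfl⟩ := hx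
  rw [τ.ρ_spec.eq_zero_iff w]
  constructor
  · rintro ⟨p, rfl⟩
    rw [τ.embedding.zero]
    exact p.2
  · intro h
    exact ⟨⟨_, h⟩, τ.embedding.injective (τ.embedding.zero ⟨_, h⟩).symm⟩

theorem ρ_m {t : ℝ} (ht : 0 ≤ t) {x : M} (hx : x ∈ τ.T) : τ.ρ (τ.m t x) = t ^ 2 * τ.ρ x := by
  obtain ⟨w, rfl⟩ := hx
  rw [τ.m_spec t ht]
  exact τ.ρ_spec.homogeneous t ht w

/-- Smoothness on the tube of maps that come from smooth maps on the normal bundle. -/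
theorem exists_smooth_lift {x : M} (hx : x ∈ τ.T) : ∃ W : Set M, IsOpen W ∧ x ∈ W ∧ W ⊆ τ.T ∧
    ∃ σ : M → TangentBundle (𝓡 n) M, ContMDiffOn (𝓡 n) (𝓡 n).tangent ∞ σ W ∧
      ∀ y ∈ W, ∃ h : (σ y).proj ∈ N, τ.Φ (NormalBundle.mk (σ y) h) = y := by
  obtain ⟨W, hW, hxW, σ, hσ, h⟩ := τ.embedding.smooth_inverse x hx
  refine ⟨W, hW, hxW, fun y hy => ?_, σ, hσ, h⟩
  obtain ⟨h', e⟩ := h y hy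
  exact ⟨_, e⟩

theorem isOpen_T : IsOpen τ.T := by
  refine isOpen_iff_mem_nhds.2 fun x hx => ?_
  obtain ⟨W, hW, hxW, hWT, -⟩ := τ.exists_smooth_lift hx
  exact mem_of_superset (hW.mem_nhds hxW) hWT

theorem contMDiffOn_ρ : ContMDiffOn (𝓡 n) 𝓘(ℝ, ℝ) ∞ τ.ρ τ.T := by
  intro x hx
  obtain ⟨W, hW, hxW, hWT, σ, hσ, h⟩ := τ.exists_smooth_lift hx
  obtain ⟨g, hg, hgρ⟩ := τ.ρ_spec.smooth
  have hgσ : ContMDiffOn (𝓡 n) 𝓘(ℝ, ℝ) ∞ (g ∘ σ) W := hg.comp hσ fun y hy => (h y hy).1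
  refine ContMDiffAt.contMDiffWithinAt
    ((hgσ.contMDiffAt (hW.mem_nhds hxW)).congr_of_eventuallyEq ?_)
  filter_upwards [hW.mem_nhds hxW] with y hy
  obtain ⟨h', e⟩ := h y hy
  exact ((hgρ _ h').trans (congrArg τ.ρ e)).symm

theorem contMDiffOn_m : ContMDiffOn (𝓘(ℝ, ℝ).prod (𝓡 n)) (𝓡 n) ∞
    (fun q : ℝ × M => τ.m q.1 q.2) (Ici 0 ×ˢ τ.T) := by
  rintro ⟨s, x⟩ ⟨hs, hx⟩
  obtain ⟨W, hW, hxW, hWT, σ, hσ, h⟩ := τ.exists_smooth_lift hx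
  obtain ⟨g, hg, hgΦ⟩ := τ.embedding.smooth
  have hσ' : ContMDiffOn (𝓘(ℝ, ℝ).prod (𝓡 n)) (𝓡 n).tangent ∞ (fun q : ℝ × M =>
      (⟨(σ q.2).proj, q.1 • (σ q.2).snd⟩ : TangentBundle (𝓡 n) M)) (univ ×ˢ W) :=
    contMDiffOn_smul_tangentBundle contMDiff_fst.contMDiffOn
      (hσ.comp contMDiff_snd.contMDiffOn fun q hq => hq.2)
  have hgσ := hg.comp hσ' fun q hq => (h q.2 hq.2).1
  have hW' : univ ×ˢ W ∈ 𝓝 (s, x) := (isOpen_univ.prod hW).mem_nhds ⟨mem_univ _, hxW⟩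
  -- `m` is specified for non-negative scalars only, so the smooth extension to all scalars agrees
  -- with it just on the half-space.
  have heq : ∀ q ∈ Ici (0 : ℝ) ×ˢ W, τ.m q.1 q.2 = (g ∘ fun q : ℝ × M =>
      (⟨(σ q.2).proj, q.1 • (σ q.2).snd⟩ : TangentBundle (𝓡 n) M)) q := by
    rintro ⟨t, y⟩ ⟨ht, hy⟩
    obtain ⟨h', e⟩ := h y hy
    have := τ.m_spec t ht (NormalBundle.mk (σ y) h')
    rw [e, NormalBundle.scale_mk] at this
    exact this.trans (hgΦ ⟨(σ y).proj, t • (σ y).snd⟩ h').symm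
  refine ((hgσ.contMDiffAt hW').contMDiffWithinAt).congr_of_eventuallyEq ?_ (heq _ ⟨hs, hxW⟩)
  filter_upwards [self_mem_nhdsWithin, mem_nhdsWithin_of_mem_nhds hW'] with q hq hq'
  exact heq q ⟨hq.1, hq'.2⟩

theorem continuousOn_m {x : M} (hx : x ∈ τ.T) : ContinuousOn (fun t => τ.m t x) (Ici 0) :=
  τ.contMDiffOn_m.continuousOn.comp (f := fun t : ℝ => (t, x)) (by fun_prop)
    fun _ ht => ⟨ht, hx⟩

/-- The transported flow lines of the Euler vector field are integral curves of `V`. -/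
theorem integralCurve_m {x : M} (hx : x ∈ τ.T) :
    IsMIntegralCurve (I := 𝓡 n) (fun t => τ.m (Real.exp t) x) τ.V := by
  obtain ⟨w, rfl⟩ := hx
  convert τ.related w using 2 with t
  exact τ.m_spec _ (Real.exp_pos t).le w

theorem tendsto_m_exp {x : M} (hx : x ∈ τ.T) :
    Tendsto (fun t => τ.m (Real.exp t) x) atBot (𝓝 (τ.m 0 x)) :=
  ((τ.continuousOn_m hx) 0 self_mem_Ici).tendsto.comp
    (tendsto_nhdsWithin_iff.2 ⟨Real.tendsto_exp_atBot,
      Eventually.of_forall fun t => (Real.exp_pos t).le⟩)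

/-- A map that preserves `N`, `U` and `V` preserves the tube and commutes with the multiplication
by scalars. -/
theorem map_m [T2Space M] (hU : IsOpen U) {a : M → M} (ha : ContMDiff (𝓡 n) (𝓡 n) ∞ a)
    (haN : ∀ x ∈ N, a x ∈ N)
    (haV : ∀ x ∈ U, mfderiv (𝓡 n) (𝓡 n) a x (τ.V x) = τ.V (a x)) {x : M} (hx : x ∈ τ.T) :
    a x ∈ τ.T ∧ ∀ s : ℝ, 0 ≤ s → τ.m s (a x) = a (τ.m s x) := by
  have hU' : ∀ y ∈ τ.T, ∀ t, τ.m (Real.exp t) y ∈ U := fun y hy t =>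
    τ.T_subset (τ.m_mem (Real.exp_pos t).le hy)
  have hγ : IsMIntegralCurve (I := 𝓡 n) (fun t => a (τ.m (Real.exp t) x)) τ.V := by
    intro t
    have h := ((ha.mdifferentiable (by simp) (τ.m (Real.exp t) x)).hasMFDerivAt).comp t
      (τ.integralCurve_m hx t)
    refine h.congr_mfderiv (ContinuousLinearMap.ext fun (r : ℝ) => ?_)
    change mfderiv (𝓡 n) (𝓡 n) a (τ.m (Real.exp t) x) ((r : ℝ) • τ.V (τ.m (Real.exp t) x)) =
      (r : ℝ) • τ.V (a (τ.m (Real.exp t) x))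
    rw [map_smul, haV _ (hU' x hx t)]
  have hlim : Tendsto (fun t => a (τ.m (Real.exp t) x)) atBot (𝓝 (a (τ.m 0 x))) :=
    (ha.continuous.tendsto _).comp (τ.tendsto_m_exp hx)
  -- Once the image curve is in the tube at one time, it is a flow line of the tube by uniqueness of
  -- integral curves.
  have key : ∀ t₀, a (τ.m (Real.exp t₀) x) ∈ τ.T →
      (fun t => τ.m (Real.exp t) (τ.m (Real.exp (-t₀)) (a (τ.m (Real.exp t₀) x)))) =
        fun t => a (τ.m (Real.exp t) x) := by
    intro t₀ h₀
    have h₁ := τ.m_mem (Real.exp_pos (-t₀)).le h₀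
    refine integralCurve_unique hU τ.eulerLike.smooth (τ.integralCurve_m h₁) hγ (hU' _ h₁)
      (t₀ := t₀) ?_
    rw [τ.m_m (Real.exp_pos _).le (Real.exp_pos _).le h₀, ← Real.exp_add, add_neg_cancel,
      Real.exp_zero, τ.m_one h₀]
  -- Such a time exists: backwards, the image curve converges to a point of `N`, and the tube is an
  -- open neighbourhood of `N`.
  have hT : a x ∈ τ.T := by
    obtain ⟨t₀, h₀⟩ := (hlim.eventually (τ.isOpen_T.mem_nhds
      (τ.subset_T (haN _ (τ.m_zero_mem hx))))).exists
    have h := congrFun (key t₀ h₀) 0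
    simp only [Real.exp_zero, τ.m_one hx] at h
    rw [← h]
    exact τ.m_mem zero_le_one (τ.m_mem (Real.exp_pos _).le h₀)
  have hexp : ∀ t, τ.m (Real.exp t) (a x) = a (τ.m (Real.exp t) x) := by
    intro t
    have h := congrFun (key 0 (by simpa [τ.m_one hx] using hT)) t
    simpa [τ.m_one hx, τ.m_one hT] using h
  refine ⟨hT, fun s hs => ?_⟩
  rcases hs.eq_or_lt with rfl | hs
  · refine tendsto_nhds_unique (τ.tendsto_m_exp hT) ?_
    simpa only [hexp] using hlim
  · simpa only [Real.exp_log hs] using hexp (Real.log s)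

end ConvenientTube

end Tubes

end StratControl

/-! ### Interaction of strata and tubes -/

namespace StratControl

/-- Connectedness of `(0, ∞)`. In the applications `P s` says that the orbit point with parameter
`s` lies in a given stratum or tube. -/
theorem forall_pos_of_clopen {P : ℝ → Prop} (h1 : P 1)
    (ho : ∀ s, 0 < s → P s → ∀ᶠ t in 𝓝 s, P t)
    (hc : ∀ s, 0 < s → (∃ᶠ t in 𝓝 s, 0 < t ∧ P t) → P s) {s : ℝ} (hs : 0 < s) : P s := by
  have hsub : Ioi (0 : ℝ) ⊆ {t | 0 < t ∧ P t} := by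
    refine isPreconnected_Ioi.subset_of_closure_inter_subset ?_ ⟨1, mem_Ioi.2 one_pos, one_pos, h1⟩ ?_
    · exact isOpen_iff_mem_nhds.2 fun t ht => (eventually_gt_nhds ht.1).and (ho t ht.1 ht.2)
    · rintro t ⟨ht, ht0⟩
      exact ⟨ht0, hc t ht0 (mem_closure_iff_frequently.1 ht)⟩
  exact (hsub hs).2

section Stratification

variable {n : ℕ} {M : Type u} [TopologicalSpace M] [ChartedSpace (EuclideanSpace ℝ (Fin n)) M]

namespace StratifiedSubset

theorem upper_anti (S : StratifiedSubset n M) {e d : ℕ} (h : e ≤ d) : S.upper d ⊆ S.upper e :=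
  fun _ hx X hX => hx X (hX.trans_le h)

theorem exists_stratum (S : StratifiedSubset n M) {x : M} (hx : x ∈ S.carrier) :
    ∃ X : S.strata, x ∈ (X : Set M) := by
  rw [← S.sUnion_strata] at hx
  obtain ⟨X, hX, h⟩ := hx
  exact ⟨⟨X, hX⟩, h⟩

theorem subset_carrier (S : StratifiedSubset n M) (X : S.strata) : (X : Set M) ⊆ S.carrier := by
  rw [← S.sUnion_strata]
  exact subset_sUnion_of_mem X.2

theorem eq_of_mem (S : StratifiedSubset n M) {X Y : S.strata} {x : M} (hX : x ∈ (X : Set M))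
    (hY : x ∈ (Y : Set M)) : X = Y := by
  by_contra h
  exact disjoint_left.1 (S.disjoint X X.2 Y Y.2 fun e => h (Subtype.ext e)) hX hY

end StratifiedSubset

end Stratification

section ControlData

variable {n : ℕ} {M : Type u} [TopologicalSpace M] [ChartedSpace (EuclideanSpace ℝ (Fin n)) M]
  [IsManifold (𝓡 n) ∞ M]

namespace ConvenientTube

variable {N U : Set M} (τ : ConvenientTube n N U)

theorem m_inv_m {s : ℝ} (hs : 0 < s) {x : M} (hx : x ∈ τ.T) : τ.m s⁻¹ (τ.m s x) = x := by
  rw [τ.m_m (inv_pos.2 hs).le hs.le hx, inv_mul_cancel₀ hs.ne', τ.m_one hx]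

theorem mem_of_m_mem {s : ℝ} (hs : 0 < s) {x : M} (hx : x ∈ τ.T) (h : τ.m s x ∈ N) : x ∈ N := by
  have h' := τ.m_inv_m hs hx
  rw [τ.m_of_mem (inv_pos.2 hs).le h] at h'
  rwa [h'] at h

theorem continuousAt_m {s : ℝ} (hs : 0 < s) {x : M} (hx : x ∈ τ.T) :
    ContinuousAt (fun t => τ.m t x) s :=
  (τ.continuousOn_m hx).continuousAt (Ici_mem_nhds hs)

end ConvenientTube

namespace TubeCollection

variable {S : StratifiedSubset n M} {τ : TubeCollection S}

namespace IsAdjusted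

/-- The tube of `X` meets `Y`, but lies in `M_d` for `d = dim X` and so misses all strata of smaller
dimension. -/
theorem dim_le_of_le (h : τ.IsAdjusted) {X Y : S.strata} (hXY : S.le X Y) : S.dim X ≤ S.dim Y := by
  obtain ⟨x, hx, hxY⟩ := (h.inter_strata X Y).2 hXY
  by_contra hlt
  exact (τ X).T_subset hx Y (not_le.1 hlt) hxY

theorem lt_of_dim_lt (h : τ.IsAdjusted) {X Y : S.strata} (hXY : S.dim X < S.dim Y) {x : M}
    (hX : x ∈ (τ X).T) (hY : x ∈ (τ Y).T) : S.lt X Y := by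
  refine ⟨?_, fun e => hXY.ne (congrArg _ e)⟩
  rcases (h.inter_tubes X Y).1 ⟨x, hX, hY⟩ with h' | h'
  · exact h'
  · exact absurd (h.dim_le_of_le h') (not_le.2 hXY)

theorem eq_of_dim_eq (h : τ.IsAdjusted) {X Y : S.strata} (hXY : S.dim X = S.dim Y) {x : M}
    (hX : x ∈ (τ X).T) (hY : x ∈ (τ Y).T) : X = Y := by
  by_contra hne
  have : x ∈ closure (τ X).T ∩ closure (τ Y).T ∩ S.upper (S.dim X) :=
    ⟨⟨subset_closure hX, subset_closure hY⟩, (τ X).T_subset hX⟩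
  rw [h.same_dim X Y hne hXY] at this
  exact this

/-- By the frontier condition, the closure of a stratum consists of strata of no larger dimension;
local finiteness then makes the union of the low-dimensional strata closed. -/
theorem isOpen_upper (h : τ.IsAdjusted) (d : ℕ) : IsOpen (S.upper d) := by
  have hlf : LocallyFinite fun X : {X : S.strata // S.dim X < d} => (X.1 : Set M) :=
    S.locallyFinite.comp_injective Subtype.val_injective
  have hcl : IsClosed (⋃ X : {X : S.strata // S.dim X < d}, (X.1 : Set M)) := by
    rw [← closure_subset_iff_isClosed, hlf.closure_iUnion]
    refine iUnion_subset fun X z hz => ?_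
    obtain ⟨Z, hZ⟩ := S.exists_stratum
      (closure_minimal (S.subset_carrier X.1) S.isClosed_carrier hz)
    have hle : S.le Z X := S.frontier Z Z.2 X.1 X.1.2 ⟨z, hZ, hz⟩
    exact mem_iUnion.2 ⟨⟨Z, (h.dim_le_of_le hle).trans_lt X.2⟩, hZ⟩
  convert hcl.isOpen_compl using 1
  ext x
  simp [StratifiedSubset.upper]

/-- Sublevels are closed only relative to `upper`, so the limit point has to be known to avoid lower
strata. -/
theorem mem_of_frequently (h : τ.IsAdjusted) (X : S.strata) {a : ℝ} (ha : 0 ≤ a) {x : M}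
    (hx : x ∈ S.upper (S.dim X)) (hf : ∃ᶠ y in 𝓝 x, y ∈ (τ X).T ∧ (τ X).ρ y ≤ a) :
    x ∈ (τ X).T ∧ (τ X).ρ x ≤ a := by
  obtain ⟨K, hK, hKe⟩ := isClosed_induced_iff.1 (h.closed_sublevel X a ha)
  have hmem : ∀ y (hy : y ∈ S.upper (S.dim X)), y ∈ K ↔ (y ∈ (τ X).T ∧ (τ X).ρ y ≤ a) :=
    fun y hy => iff_of_eq (congrArg (fun A : Set (S.upper (S.dim X)) => ⟨y, hy⟩ ∈ A) hKe)
  refine (hmem x hx).1 (hK.mem_of_frequently_of_tendsto (hf.mono fun y hy => ?_) tendsto_id)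
  exact (hmem y ((τ X).T_subset hy.1)).2 hy

end IsAdjusted

namespace IsCommutativeTangentialControlData

/-- For `Y ≠ Z`, commutativity keeps `ρ_Z` constant along the orbit near a point of `Z`, and `Z` is
the zero set of `ρ_Z`. For `Y = Z` the orbit is constant. -/
theorem eventually_m_mem_stratum (h : τ.IsCommutativeTangentialControlData) {Y Z : S.strata}
    {z : M} (hz : z ∈ (τ Y).T) {s : ℝ} (hs : 0 < s) (hZ : (τ Y).m s z ∈ (Z : Set M)) :
    ∀ᶠ t in 𝓝 s, (τ Y).m t z ∈ (Z : Set M) := by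
  by_cases hYZ : Y = Z
  · subst hYZ
    have hzY := (τ Y).mem_of_m_mem hs hz hZ
    filter_upwards [eventually_ge_nhds hs] with t ht
    rwa [(τ Y).m_of_mem ht hzY]
  · have hp := (τ Y).m_mem hs.le hz
    have hlt : S.lt Y Z := ⟨(h.adjusted.inter_strata Y Z).1 ⟨_, hp, hZ⟩, hYZ⟩
    have hpZ := (τ Z).subset_T hZ
    filter_upwards [eventually_gt_nhds hs, ((τ Y).continuousAt_m hs hz).eventually
      ((τ Z).isOpen_T.mem_nhds hpZ)] with t ht htZ
    have e : (τ Y).m (t / s) ((τ Y).m s z) = (τ Y).m t z := by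
      rw [(τ Y).m_m (div_pos ht hs).le hs.le hz, div_mul_cancel₀ _ hs.ne']
    have hc := (h.commutative Y Z hlt (t / s) (div_pos ht hs) _ ⟨hp, hpZ⟩ (by rwa [e])).2
    rw [e, ((τ Z).ρ_eq_zero_iff hpZ).2 hZ] at hc
    exact ((τ Z).ρ_eq_zero_iff htZ).1 hc

/-- Multiplication by a positive scalar in a tube preserves all strata. -/
theorem m_mem_stratum (h : τ.IsCommutativeTangentialControlData) {Y Z : S.strata}
    {z : M} (hz : z ∈ (τ Y).T) (hZ : z ∈ (Z : Set M)) {s : ℝ} (hs : 0 < s) :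
    (τ Y).m s z ∈ (Z : Set M) := by
  refine forall_pos_of_clopen (P := fun s => (τ Y).m s z ∈ (Z : Set M))
    (by rwa [(τ Y).m_one hz]) (fun t ht hP => h.eventually_m_mem_stratum hz ht hP) ?_ hs
  -- A limit of points of `Z` lies in the closed set `C`, hence in some stratum `Z'`. Nearby orbit
  -- points then lie in `Z'` as well as in `Z`, so `Z' = Z`.
  intro t ht hf
  have hC : (τ Y).m t z ∈ S.carrier := S.isClosed_carrier.mem_of_frequently_of_tendsto
    (hf.mono fun r hr => S.subset_carrier Z hr.2) ((τ Y).continuousAt_m ht hz)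
  obtain ⟨Z', hZ'⟩ := S.exists_stratum hC
  obtain ⟨r, ⟨-, hrZ⟩, hrZ'⟩ := (hf.and_eventually (h.eventually_m_mem_stratum hz ht hZ')).exists
  rwa [S.eq_of_mem hrZ hrZ']

/-- Multiplication by a positive scalar in the tube of a stratum preserves the tubes and the
distance functions of the strata of higher dimension. -/
theorem m_mem_higher (h : τ.IsCommutativeTangentialControlData) {Y X : S.strata}
    (hd : S.dim Y < S.dim X) {x : M} (hY : x ∈ (τ Y).T) (hX : x ∈ (τ X).T) {s : ℝ} (hs : 0 < s) :
    (τ Y).m s x ∈ (τ X).T ∧ (τ X).ρ ((τ Y).m s x) = (τ X).ρ x := by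
  have hlt := h.adjusted.lt_of_dim_lt hd hY hX
  have hρ : ∀ t, 0 < t → (τ Y).m t x ∈ (τ X).T → (τ X).ρ ((τ Y).m t x) = (τ X).ρ x :=
    fun t ht hm => (h.commutative Y X hlt t ht x ⟨hY, hX⟩ hm).2
  suffices hm : (τ Y).m s x ∈ (τ X).T from ⟨hm, hρ s hs hm⟩
  refine forall_pos_of_clopen (P := fun s => (τ Y).m s x ∈ (τ X).T)
    (by rwa [(τ Y).m_one hY]) (fun t ht hP => ((τ Y).continuousAt_m ht hY).eventually
      ((τ X).isOpen_T.mem_nhds hP)) ?_ hs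
  intro t ht hf
  -- If the orbit met a stratum of dimension below `dim X`, multiplying back would put `x` itself
  -- into that stratum.
  have hup : (τ Y).m t x ∈ S.upper (S.dim X) := by
    intro Z hZd hZ
    have := h.m_mem_stratum ((τ Y).m_mem ht.le hY) hZ (inv_pos.2 ht)
    rw [(τ Y).m_inv_m ht hY] at this
    exact (τ X).T_subset hX Z hZd this
  refine (h.adjusted.mem_of_frequently X ((τ X).ρ_nonneg hX) hup
    (((τ Y).continuousAt_m ht hY).frequently (hf.mono fun r hr => ?_))).1
  exact ⟨hr.2, (hρ r hr.1 hr.2).le⟩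

/-- Multiplication by a non-negative scalar in the tube of a stratum preserves the tubes and the
distance functions of the strata of lower dimension. -/
theorem m_mem_lower (h : τ.IsCommutativeTangentialControlData) {X Y : S.strata}
    (hd : S.dim X < S.dim Y) {x : M} (hX : x ∈ (τ X).T) (hY : x ∈ (τ Y).T) {t : ℝ} (ht : 0 ≤ t) :
    (τ Y).m t x ∈ (τ X).T ∧ (τ X).ρ ((τ Y).m t x) = (τ X).ρ x := by
  have hlt := h.adjusted.lt_of_dim_lt hd hX hY
  have hρ : ∀ t, 0 ≤ t → (τ Y).m t x ∈ (τ X).T → (τ X).ρ ((τ Y).m t x) = (τ X).ρ x :=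
    fun t ht hm => (h.preCommutative X Y hlt t ht x ⟨hX, hY⟩ hm).2
  suffices hm : (τ Y).m t x ∈ (τ X).T from ⟨hm, hρ t ht hm⟩
  have hup : ∀ s, 0 ≤ s → (τ Y).m s x ∈ S.upper (S.dim X) := fun s hs =>
    S.upper_anti hd.le ((τ Y).T_subset ((τ Y).m_mem hs hY))
  have hpos : ∀ s, 0 < s → (τ Y).m s x ∈ (τ X).T := by
    intro s hs
    refine forall_pos_of_clopen (P := fun s => (τ Y).m s x ∈ (τ X).T)
      (by rwa [(τ Y).m_one hY]) (fun t ht hP => ((τ Y).continuousAt_m ht hY).eventually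
        ((τ X).isOpen_T.mem_nhds hP)) ?_ hs
    intro r hr hf
    exact (h.adjusted.mem_of_frequently X ((τ X).ρ_nonneg hX) (hup r hr.le)
      (((τ Y).continuousAt_m hr hY).frequently
        (hf.mono fun q hq => ⟨hq.2, (hρ q hq.1.le hq.2).le⟩))).1
  rcases ht.eq_or_lt with rfl | ht
  -- The scalar 0 is reached as the limit of `exp q` for `q → -∞`.
  · refine (h.adjusted.mem_of_frequently X ((τ X).ρ_nonneg hX) (hup 0 le_rfl)
      (((τ Y).tendsto_m_exp hY).frequently (Frequently.of_forall fun q => ?_))).1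
    have hq := hpos _ (Real.exp_pos q)
    exact ⟨hq, (hρ _ (Real.exp_pos q).le hq).le⟩
  · exact hpos t ht

end IsCommutativeTangentialControlData

end TubeCollection

end ControlData

end StratControl

noncomputable section

namespace StratControl

/-! ### Multiplication and distance by dimension -/

section Retraction

theorem contMDiffAt_smoothTransition_comp {E' H' M' : Type*} [NormedAddCommGroup E']
    [NormedSpace ℝ E'] [TopologicalSpace H'] {I' : ModelWithCorners ℝ E' H'} [TopologicalSpace M']
    [ChartedSpace H' M'] {f : M' → ℝ} {x : M'} (hf : ContMDiffAt I' 𝓘(ℝ, ℝ) ∞ f x) (a b : ℝ) :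
    ContMDiffAt I' 𝓘(ℝ, ℝ) ∞ (fun y => Real.smoothTransition (a * f y + b)) x := by
  have h : ContDiff ℝ ∞ fun r : ℝ => Real.smoothTransition (a * r + b) :=
    Real.smoothTransition.contDiff.comp (by fun_prop)
  exact h.contMDiff.contMDiffAt.comp x hf

variable {n : ℕ} {M : Type u} [TopologicalSpace M] [ChartedSpace (EuclideanSpace ℝ (Fin n)) M]
  [IsManifold (𝓡 n) ∞ M]

namespace TubeCollection

variable {S : StratifiedSubset n M} (τ : TubeCollection S)

/-- The union of the tubes of the strata of dimension `d`. -/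
def tubes (d : ℕ) : Set M := {x | ∃ X : S.strata, S.dim X = d ∧ x ∈ (τ X).T}

open scoped Classical in
/-- The multiplication by scalars on the tubes of the strata of dimension `d`, extended by the
identity. -/
def mul (d : ℕ) (t : ℝ) (x : M) : M :=
  if h : ∃ X : S.strata, S.dim X = d ∧ x ∈ (τ X).T then (τ h.choose).m t x else x

open scoped Classical in
/-- The distance function on the tubes of the strata of dimension `d`, extended by zero. -/
def dist (d : ℕ) (x : M) : ℝ :=
  if h : ∃ X : S.strata, S.dim X = d ∧ x ∈ (τ X).T then (τ h.choose).ρ x else 0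

variable {τ}

theorem mul_of_notMem {d : ℕ} {x : M} (hx : x ∉ τ.tubes d) (t : ℝ) : τ.mul d t x = x :=
  dif_neg hx

theorem mem_tubes {X : S.strata} {x : M} (hx : x ∈ (τ X).T) : x ∈ τ.tubes (S.dim X) :=
  ⟨X, rfl, hx⟩

theorem isOpen_tubes (d : ℕ) : IsOpen (τ.tubes d) := by
  refine isOpen_iff_mem_nhds.2 fun x ⟨X, hX, hx⟩ => ?_
  filter_upwards [(τ X).isOpen_T.mem_nhds hx] with y hy
  exact ⟨X, hX, hy⟩

theorem tubes_subset_upper (d : ℕ) : τ.tubes d ⊆ S.upper d := by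
  rintro x ⟨X, rfl, hx⟩
  exact (τ X).T_subset hx

namespace IsAdjusted

theorem mul_eq (h : τ.IsAdjusted) {X : S.strata} {x : M} (hx : x ∈ (τ X).T) (t : ℝ) :
    τ.mul (S.dim X) t x = (τ X).m t x := by
  have hex : ∃ Y : S.strata, S.dim Y = S.dim X ∧ x ∈ (τ Y).T := ⟨X, rfl, hx⟩
  rw [mul, dif_pos hex, h.eq_of_dim_eq hex.choose_spec.1 hex.choose_spec.2 hx]

theorem dist_eq (h : τ.IsAdjusted) {X : S.strata} {x : M} (hx : x ∈ (τ X).T) :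
    τ.dist (S.dim X) x = (τ X).ρ x := by
  have hex : ∃ Y : S.strata, S.dim Y = S.dim X ∧ x ∈ (τ Y).T := ⟨X, rfl, hx⟩
  rw [dist, dif_pos hex, h.eq_of_dim_eq hex.choose_spec.1 hex.choose_spec.2 hx]

theorem dist_nonneg (h : τ.IsAdjusted) {d : ℕ} {x : M} (hx : x ∈ τ.tubes d) : 0 ≤ τ.dist d x := by
  obtain ⟨X, rfl, hx⟩ := hx
  rw [h.dist_eq hx]
  exact (τ X).ρ_nonneg hx

theorem mul_one (h : τ.IsAdjusted) (d : ℕ) (x : M) : τ.mul d 1 x = x := by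
  by_cases hx : x ∈ τ.tubes d
  · obtain ⟨X, rfl, hx⟩ := hx
    rw [h.mul_eq hx, (τ X).m_one hx]
  · exact mul_of_notMem hx 1

theorem mul_mem (h : τ.IsAdjusted) {d : ℕ} {x : M} (hx : x ∈ τ.tubes d) {t : ℝ} (ht : 0 ≤ t) :
    τ.mul d t x ∈ τ.tubes d ∧ τ.dist d (τ.mul d t x) = t ^ 2 * τ.dist d x := by
  obtain ⟨X, rfl, hx⟩ := hx
  have hm := (τ X).m_mem ht hx
  rw [h.mul_eq hx, h.dist_eq hx, h.dist_eq hm]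
  exact ⟨mem_tubes hm, (τ X).ρ_m ht hx⟩

theorem mem_carrier_iff (h : τ.IsAdjusted) {x : M} :
    x ∈ S.carrier ↔ ∃ d, x ∈ τ.tubes d ∧ τ.dist d x ≤ 0 := by
  constructor
  · intro hx
    obtain ⟨X, hX⟩ := S.exists_stratum hx
    have hT := (τ X).subset_T hX
    exact ⟨_, mem_tubes hT, ((h.dist_eq hT).trans (((τ X).ρ_eq_zero_iff hT).2 hX)).le⟩
  · rintro ⟨d, ⟨X, rfl, hx⟩, h0⟩
    rw [h.dist_eq hx] at h0
    exact S.subset_carrier X (((τ X).ρ_eq_zero_iff hx).1 (h0.antisymm ((τ X).ρ_nonneg hx)))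

theorem mem_neighbourhood_iff (h : τ.IsAdjusted) {x : M} :
    x ∈ τ.neighbourhood ↔ ∃ d, x ∈ τ.tubes d ∧ τ.dist d x < 1 := by
  constructor
  · intro hx
    obtain ⟨X, hx, h1⟩ := mem_iUnion.1 hx
    exact ⟨_, mem_tubes hx, (h.dist_eq hx).trans_lt h1⟩
  · rintro ⟨d, ⟨X, rfl, hx⟩, h1⟩
    exact mem_iUnion.2 ⟨X, hx, (h.dist_eq hx).symm.trans_lt h1⟩

theorem contMDiffOn_dist (h : τ.IsAdjusted) (d : ℕ) :
    ContMDiffOn (𝓡 n) 𝓘(ℝ, ℝ) ∞ (τ.dist d) (τ.tubes d) := by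
  rintro x ⟨X, rfl, hx⟩
  have hT := (τ X).isOpen_T.mem_nhds hx
  refine ContMDiffAt.contMDiffWithinAt
    (((τ X).contMDiffOn_ρ.contMDiffAt hT).congr_of_eventuallyEq ?_)
  filter_upwards [hT] with y hy
  exact h.dist_eq hy

theorem contMDiffOn_mul (h : τ.IsAdjusted) (d : ℕ) :
    ContMDiffOn (𝓘(ℝ, ℝ).prod (𝓡 n)) (𝓡 n) ∞ (fun q : ℝ × M => τ.mul d q.1 q.2)
      (Ici 0 ×ˢ τ.tubes d) := by
  rintro ⟨s, x⟩ ⟨hs, X, rfl, hx⟩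
  have hT : univ ×ˢ (τ X).T ∈ 𝓝 (s, x) :=
    (isOpen_univ.prod (τ X).isOpen_T).mem_nhds ⟨mem_univ _, hx⟩
  refine (((τ X).contMDiffOn_m (s, x) ⟨hs, hx⟩).mono_of_mem_nhdsWithin
    ?_).congr_of_eventuallyEq ?_ (h.mul_eq hx s)
  · filter_upwards [self_mem_nhdsWithin, mem_nhdsWithin_of_mem_nhds hT] with q hq hq'
    exact ⟨hq.1, hq'.2⟩
  · filter_upwards [mem_nhdsWithin_of_mem_nhds hT] with q hq
    exact h.mul_eq hq.2 q.1

end IsAdjusted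

namespace IsCommutativeTangentialControlData

/-- Local finiteness reduces the closedness of the union of closed tubes to that of finitely many.
-/
theorem mem_tubes_of_frequently (h : τ.IsCommutativeTangentialControlData) {d : ℕ} {a : ℝ}
    (ha : 0 ≤ a) {x : M} (hx : x ∈ S.upper d)
    (hf : ∃ᶠ y in 𝓝 x, y ∈ τ.tubes d ∧ τ.dist d y ≤ a) : x ∈ τ.tubes d := by
  by_contra hxT
  obtain ⟨W, hW, hfin⟩ := h.locallyFinite d x hx
  have hev : ∀ᶠ y in 𝓝 x, ∀ X ∈ {X | S.dim X = d ∧ ((τ X).T ∩ W).Nonempty},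
      ¬ (y ∈ (τ X).T ∧ (τ X).ρ y ≤ a) := by
    refine (eventually_all_finite hfin).2 fun X hX => not_frequently.1 fun hf' => hxT ?_
    obtain ⟨rfl, -⟩ := hX
    exact mem_tubes (h.adjusted.mem_of_frequently X ha hx hf').1
  obtain ⟨y, ⟨⟨X, rfl, hyX⟩, hya⟩, hy, hyW⟩ := (hf.and_eventually (hev.and hW)).exists
  rw [h.adjusted.dist_eq hyX] at hya
  exact hy X ⟨rfl, y, hyX, hyW⟩ ⟨hyX, hya⟩

theorem mul_mem_lower (h : τ.IsCommutativeTangentialControlData) {e d : ℕ} (hed : e < d) {x : M}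
    (hx : x ∈ τ.tubes e) {t : ℝ} (ht : 0 ≤ t) :
    τ.mul d t x ∈ τ.tubes e ∧ τ.dist e (τ.mul d t x) = τ.dist e x := by
  by_cases hxd : x ∈ τ.tubes d
  · obtain ⟨X, rfl, hX⟩ := hx
    obtain ⟨Y, rfl, hY⟩ := hxd
    have hm := h.m_mem_lower hed hX hY ht
    rw [h.adjusted.mul_eq hY, h.adjusted.dist_eq hX, h.adjusted.dist_eq hm.1]
    exact ⟨mem_tubes hm.1, hm.2⟩
  · rw [mul_of_notMem hxd]
    exact ⟨hx, rfl⟩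

theorem mul_mem_higher (h : τ.IsCommutativeTangentialControlData) {d e : ℕ} (hde : d < e) {x : M}
    (hx : x ∈ τ.tubes e) {s : ℝ} (hs : 0 < s) :
    τ.mul d s x ∈ τ.tubes e ∧ τ.dist e (τ.mul d s x) = τ.dist e x := by
  by_cases hxd : x ∈ τ.tubes d
  · obtain ⟨X, rfl, hX⟩ := hx
    obtain ⟨Y, rfl, hY⟩ := hxd
    have hm := h.m_mem_higher hde hY hX hs
    rw [h.adjusted.mul_eq hY, h.adjusted.dist_eq hX, h.adjusted.dist_eq hm.1]
    exact ⟨mem_tubes hm.1, hm.2⟩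
  · rw [mul_of_notMem hxd]
    exact ⟨hx, rfl⟩

/-- Multiplication by a scalar in `[0, 1]` does not increase the least distance to the strata. -/
theorem exists_dist_mul_le (h : τ.IsCommutativeTangentialControlData) {d e : ℕ} {x : M}
    (hx : x ∈ τ.tubes e) {s : ℝ} (hs : s ∈ Icc (0 : ℝ) 1) :
    ∃ e', τ.mul d s x ∈ τ.tubes e' ∧ τ.dist e' (τ.mul d s x) ≤ τ.dist e x := by
  by_cases hxd : x ∈ τ.tubes d
  · have hxe := h.adjusted.dist_nonneg hx
    obtain ⟨hm, hρ⟩ := h.adjusted.mul_mem hxd hs.1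
    rcases lt_trichotomy e d with hed | rfl | hde
    · obtain ⟨hm, hρ⟩ := h.mul_mem_lower hed hx hs.1
      exact ⟨e, hm, hρ.le⟩
    · refine ⟨e, hm, hρ.le.trans (mul_le_of_le_one_left hxe (pow_le_one₀ hs.1 hs.2))⟩
    -- The scalar 0 may leave the tube of dimension `e`, but it lands in a stratum of dimension `d`,
    -- where `dist d` is 0.
    · rcases hs.1.eq_or_lt with rfl | hs0
      · exact ⟨d, hm, by rw [hρ]; simpa using hxe⟩
      · obtain ⟨hm, hρ⟩ := h.mul_mem_higher hde hx hs0
        exact ⟨e, hm, hρ.le⟩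
  · rw [mul_of_notMem hxd]
    exact ⟨e, hx, le_rfl⟩

end IsCommutativeTangentialControlData

/-! ### Cutoff functions and weights -/

variable (τ)

open scoped Classical in
/-- A function that vanishes near the strata of dimension `d` and is one outside the open tubes of
radius one around them. -/
def cutoff (d : ℕ) (x : M) : ℝ :=
  if x ∈ τ.tubes d then Real.smoothTransition (2 * τ.dist d x - 1) else 1

open scoped Classical in
/-- A bump function with support in the tubes of the strata of dimension `d`, away from the strata
of lower dimension. -/
def weight (d : ℕ) (x : M) : ℝ :=
  if x ∈ τ.tubes d then
    Real.smoothTransition (2 - τ.dist d x) * ∏ e ∈ Finset.range d, τ.cutoff e x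
  else 0

variable {τ}

theorem cutoff_mem_Icc (d : ℕ) (x : M) : τ.cutoff d x ∈ Icc (0 : ℝ) 1 := by
  unfold cutoff
  split_ifs
  · exact ⟨Real.smoothTransition.nonneg _, Real.smoothTransition.le_one _⟩
  · simp

theorem weight_mem_Icc (d : ℕ) (x : M) : τ.weight d x ∈ Icc (0 : ℝ) 1 := by
  unfold weight
  split_ifs
  · have h0 : 0 ≤ ∏ e ∈ Finset.range d, τ.cutoff e x :=
      Finset.prod_nonneg fun e _ => (cutoff_mem_Icc e x).1
    have h1 : ∏ e ∈ Finset.range d, τ.cutoff e x ≤ 1 :=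
      Finset.prod_le_one (fun e _ => (cutoff_mem_Icc e x).1) fun e _ => (cutoff_mem_Icc e x).2
    exact ⟨mul_nonneg (Real.smoothTransition.nonneg _) h0,
      mul_le_one₀ (Real.smoothTransition.le_one _) h0 h1⟩
  · simp

theorem weight_eq_one {d : ℕ} {x : M} (hx : x ∈ τ.tubes d) (h1 : τ.dist d x ≤ 1)
    (hlow : ∀ e < d, x ∈ τ.tubes e → 1 ≤ τ.dist e x) : τ.weight d x = 1 := by
  rw [weight, if_pos hx, Real.smoothTransition.one_of_one_le (by linarith), one_mul]
  refine Finset.prod_eq_one fun e he => ?_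
  by_cases hxe : x ∈ τ.tubes e
  · have := hlow e (Finset.mem_range.1 he) hxe
    rw [cutoff, if_pos hxe, Real.smoothTransition.one_of_one_le (by linarith)]
  · exact if_neg hxe

namespace IsCommutativeTangentialControlData

theorem contMDiffAt_cutoff (h : τ.IsCommutativeTangentialControlData) {d : ℕ} {x : M}
    (hx : x ∈ S.upper d) : ContMDiffAt (𝓡 n) 𝓘(ℝ, ℝ) ∞ (τ.cutoff d) x := by
  by_cases hxT : x ∈ τ.tubes d
  · have hT := (τ.isOpen_tubes d).mem_nhds hxT
    refine (contMDiffAt_smoothTransition_comp ((h.adjusted.contMDiffOn_dist d).contMDiffAt hT)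
      2 (-1)).congr_of_eventuallyEq ?_
    filter_upwards [hT] with y hy
    rw [cutoff, if_pos hy, sub_eq_add_neg]
  · have hev := not_frequently.1 (mt (h.mem_tubes_of_frequently zero_le_one hx) hxT)
    refine (contMDiffAt_const (c := (1 : ℝ))).congr_of_eventuallyEq ?_
    filter_upwards [hev] with y hy
    by_cases hyT : y ∈ τ.tubes d
    · have : 1 < τ.dist d y := not_le.1 fun hle => hy ⟨hyT, hle⟩
      rw [cutoff, if_pos hyT, Real.smoothTransition.one_of_one_le (by linarith)]
    · exact if_neg hyT

/-- Within `upper d`, the region `dist d ≤ 2` supporting the first factor is relatively closed. At a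
point of a lower stratum, the cutoff of that dimension vanishes nearby. -/
theorem eventually_weight_eq_zero (h : τ.IsCommutativeTangentialControlData) {d : ℕ} {x : M}
    (hxT : x ∉ τ.tubes d) : ∀ᶠ y in 𝓝 x, τ.weight d y = 0 := by
  by_cases hx : x ∈ S.upper d
  · filter_upwards [not_frequently.1 (mt (h.mem_tubes_of_frequently zero_le_two hx) hxT)] with y hy
    by_cases hyT : y ∈ τ.tubes d
    · have : 2 < τ.dist d y := not_le.1 fun hle => hy ⟨hyT, hle⟩
      rw [weight, if_pos hyT, Real.smoothTransition.zero_of_nonpos (by linarith), zero_mul]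
    · exact if_neg hyT
  · obtain ⟨X, hXd, hxX⟩ : ∃ X : S.strata, S.dim X < d ∧ x ∈ (X : Set M) := by
      simpa [StratifiedSubset.upper] using hx
    have hT := (τ X).subset_T hxX
    have hlt : ∀ᶠ y in 𝓝 x, (τ X).ρ y < 1 / 2 := by
      refine ((τ X).contMDiffOn_ρ.contMDiffAt
        ((τ X).isOpen_T.mem_nhds hT)).continuousAt.eventually_lt_const ?_
      rw [((τ X).ρ_eq_zero_iff hT).2 hxX]
      norm_num
    filter_upwards [hlt, (τ X).isOpen_T.mem_nhds hT] with y hy hyT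
    have hcut : τ.cutoff (S.dim X) y = 0 := by
      rw [cutoff, if_pos (mem_tubes hyT), h.adjusted.dist_eq hyT,
        Real.smoothTransition.zero_of_nonpos (by linarith)]
    rw [weight, Finset.prod_eq_zero (Finset.mem_range.2 hXd) hcut, mul_zero, ite_self]

theorem contMDiff_weight (h : τ.IsCommutativeTangentialControlData) (d : ℕ) :
    ContMDiff (𝓡 n) 𝓘(ℝ, ℝ) ∞ (τ.weight d) := by
  intro x
  by_cases hxT : x ∈ τ.tubes d
  · have hT := (τ.isOpen_tubes d).mem_nhds hxT
    have hprod : ContMDiffAt (𝓡 n) 𝓘(ℝ, ℝ) ∞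
        (fun y => ∏ e ∈ Finset.range d, τ.cutoff e y) x :=
      contMDiffAt_finsetProd fun e he => h.contMDiffAt_cutoff
        (S.upper_anti (Finset.mem_range.1 he).le (τ.tubes_subset_upper d hxT))
    refine ((contMDiffAt_smoothTransition_comp ((h.adjusted.contMDiffOn_dist d).contMDiffAt hT)
      (-1) 2).mul hprod).congr_of_eventuallyEq ?_
    filter_upwards [hT] with y hy
    rw [weight, if_pos hy, Pi.mul_apply, neg_one_mul, neg_add_eq_sub]
  · exact (contMDiffAt_const (c := (0 : ℝ))).congr_of_eventuallyEq
      (h.eventually_weight_eq_zero hxT)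

end IsCommutativeTangentialControlData

/-! ### The homotopy -/

variable (τ)

/-- The homotopy that retracts tubes of the strata of dimension `d`. -/
def step (d : ℕ) (q : M × unitInterval) : M := τ.mul d (1 - q.2 * τ.weight d q.1) q.1

/-- The homotopy that retracts successively the tubes of the strata of dimension
`k - 1, …, 1, 0`. -/
def homotopy : ℕ → M × unitInterval → M
  | 0, q => q.1
  | k + 1, q => homotopy k (τ.step k q, q.2)

variable {τ}

theorem scalar_mem_Icc (d : ℕ) (q : M × unitInterval) :
    1 - q.2 * τ.weight d q.1 ∈ Icc (0 : ℝ) 1 := by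
  have h := weight_mem_Icc (τ := τ) d q.1
  have h' := mul_nonneg q.2.2.1 h.1
  exact ⟨sub_nonneg.2 (mul_le_one₀ q.2.2.2 h.1 h.2), by linarith⟩

namespace IsCommutativeTangentialControlData

theorem contMDiff_step (h : τ.IsCommutativeTangentialControlData) (d : ℕ) :
    ContMDiff ((𝓡 n).prod (𝓡∂ 1)) (𝓡 n) ∞ (τ.step d) := by
  have hs : ContMDiff ((𝓡 n).prod (𝓡∂ 1)) 𝓘(ℝ, ℝ) ∞
      (fun q : M × unitInterval => 1 - (q.2 : ℝ) * τ.weight d q.1) :=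
    contMDiff_const.sub ((contMDiff_subtypeVal_Icc.comp contMDiff_snd).mul
      ((h.contMDiff_weight d).comp contMDiff_fst))
  intro q
  by_cases hq : q.1 ∈ τ.tubes d
  · have hT : Prod.fst ⁻¹' τ.tubes d ∈ 𝓝 q :=
      ((τ.isOpen_tubes d).preimage continuous_fst).mem_nhds hq
    refine ContMDiffOn.contMDiffAt ?_ hT
    exact (h.adjusted.contMDiffOn_mul d).comp
      ((hs.prodMk contMDiff_fst).contMDiffOn) fun p hp => ⟨(scalar_mem_Icc d p).1, hp⟩
  · refine contMDiffAt_fst.congr_of_eventuallyEq ?_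
    filter_upwards [continuous_fst.continuousAt.eventually (h.eventually_weight_eq_zero hq)]
      with p hp
    rw [step, hp, mul_zero, sub_zero, h.adjusted.mul_one]

theorem contMDiff_homotopy (h : τ.IsCommutativeTangentialControlData) (k : ℕ) :
    ContMDiff ((𝓡 n).prod (𝓡∂ 1)) (𝓡 n) ∞ (τ.homotopy k) := by
  induction k with
  | zero => exact contMDiff_fst
  | succ k ih => exact ih.comp ((h.contMDiff_step k).prodMk contMDiff_snd)

theorem homotopy_zero (h : τ.IsCommutativeTangentialControlData) (k : ℕ) (x : M) :
    τ.homotopy k (x, 0) = x := by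
  induction k generalizing x with
  | zero => rfl
  | succ k ih =>
    have hstep : τ.step k (x, 0) = x := by simp [step, h.adjusted.mul_one]
    simp [homotopy, hstep, ih]

theorem exists_dist_homotopy_le (h : τ.IsCommutativeTangentialControlData) (k : ℕ) {e : ℕ} {x : M}
    (hx : x ∈ τ.tubes e) (t : unitInterval) : ∃ e', τ.homotopy k (x, t) ∈ τ.tubes e' ∧
      τ.dist e' (τ.homotopy k (x, t)) ≤ τ.dist e x := by
  induction k generalizing x e with
  | zero => exact ⟨e, hx, le_rfl⟩
  | succ k ih =>
    obtain ⟨e₁, h₁, hle₁⟩ := h.exists_dist_mul_le hx (scalar_mem_Icc (τ := τ) k (x, t))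
    obtain ⟨e₂, h₂, hle₂⟩ := ih h₁
    exact ⟨e₂, h₂, hle₂.trans hle₁⟩

theorem homotopy_mem_carrier (h : τ.IsCommutativeTangentialControlData) (k : ℕ) {x : M}
    (hx : x ∈ S.carrier) (t : unitInterval) : τ.homotopy k (x, t) ∈ S.carrier := by
  obtain ⟨d, hd, h0⟩ := h.adjusted.mem_carrier_iff.1 hx
  obtain ⟨e, he, hle⟩ := h.exists_dist_homotopy_le k hd t
  exact h.adjusted.mem_carrier_iff.2 ⟨e, he, hle.trans h0⟩

theorem homotopy_mem_neighbourhood (h : τ.IsCommutativeTangentialControlData) (k : ℕ) {x : M}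
    (hx : x ∈ τ.neighbourhood) (t : unitInterval) : τ.homotopy k (x, t) ∈ τ.neighbourhood := by
  obtain ⟨d, hd, h1⟩ := h.adjusted.mem_neighbourhood_iff.1 hx
  obtain ⟨e, he, hle⟩ := h.exists_dist_homotopy_le k hd t
  exact h.adjusted.mem_neighbourhood_iff.2 ⟨e, he, hle.trans_lt h1⟩

theorem homotopy_one_mem_carrier (h : τ.IsCommutativeTangentialControlData) (k : ℕ) {x : M}
    (hx : ∃ e < k, x ∈ τ.tubes e ∧ τ.dist e x < 1) : τ.homotopy k (x, 1) ∈ S.carrier := by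
  induction k generalizing x with
  | zero => simp at hx
  | succ k ih =>
    by_cases hlow : ∃ e < k, x ∈ τ.tubes e ∧ τ.dist e x < 1
    · obtain ⟨e, he, hxe, h1⟩ := hlow
      obtain ⟨hm, hρ⟩ := h.mul_mem_lower he hxe (scalar_mem_Icc (τ := τ) k (x, 1)).1
      exact ih ⟨e, he, hm, hρ.trans_lt h1⟩
    -- No lower distance is below 1, so the weight is 1 and the factor at time 1 is 0.
    · obtain ⟨e, he, hxe, h1⟩ := hx
      obtain rfl : e = k := (Nat.lt_succ_iff_lt_or_eq.1 he).resolve_left fun hlt =>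
        hlow ⟨e, hlt, hxe, h1⟩
      have hw : τ.weight e x = 1 := weight_eq_one hxe h1.le fun i hi hxi =>
        not_lt.1 fun hlt => hlow ⟨i, hi, hxi, hlt⟩
      have hstep : τ.step e (x, 1) = τ.mul e 0 x := by simp [step, hw]
      obtain ⟨hm, hρ⟩ := h.adjusted.mul_mem hxe le_rfl
      refine h.homotopy_mem_carrier e ?_ 1
      rw [hstep]
      exact h.adjusted.mem_carrier_iff.2 ⟨e, hm, by simp [hρ]⟩

theorem restrictsToWeakDeformationRetraction (h : τ.IsCommutativeTangentialControlData) :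
    RestrictsToWeakDeformationRetraction (n := n) (τ.homotopy (n + 1)) τ.neighbourhood
      S.carrier where
  smooth := h.contMDiff_homotopy _
  isOpen := isOpen_iUnion fun X =>
    (τ X).contMDiffOn_ρ.continuousOn.isOpen_inter_preimage (τ X).isOpen_T isOpen_Iio
  subset x hx := by
    obtain ⟨d, hd, h0⟩ := h.adjusted.mem_carrier_iff.1 hx
    exact h.adjusted.mem_neighbourhood_iff.2 ⟨d, hd, h0.trans_lt one_pos⟩
  mapsTo x hx t := h.homotopy_mem_neighbourhood _ hx t
  at_zero x _ := h.homotopy_zero _ x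
  at_one x hx := by
    obtain ⟨d, ⟨X, rfl, hd⟩, h1⟩ := h.adjusted.mem_neighbourhood_iff.1 hx
    -- Strata have dimension at most `n`, so `n + 1` steps treat them all.
    exact h.homotopy_one_mem_carrier _
      ⟨_, Nat.lt_succ_iff.2 (S.submanifold X).1, mem_tubes hd, h1⟩
  preserves x hx t := h.homotopy_mem_carrier _ hx t

/-- Invariance of `V` and of the strata makes `G` preserve tubes and multiplications by `map_m`;
with invariant `ρ` the weights are invariant too, so each step is equivariant. -/
theorem homotopy_smul [T2Space M] {G : Type w} [Group G] [MulAction G M]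
    (h : τ.IsCommutativeTangentialControlData)
    (hsmooth : ∀ g : G, ContMDiff (𝓡 n) (𝓡 n) ∞ fun x : M => g • x)
    (hS : IsGStratification G S) (hG : τ.IsEquivariant G) (k : ℕ) (g : G) (x : M)
    (t : unitInterval) : τ.homotopy k (g • x, t) = g • τ.homotopy k (x, t) := by
  have hupper : ∀ (g : G) (d : ℕ), ∀ x ∈ S.upper d, g • x ∈ S.upper d := by
    intro g d x hx X hX hgx
    have := hS X X.2 g⁻¹ _ hgx
    rw [inv_smul_smul] at this
    exact hx X hX this
  have hm : ∀ (g : G) (X : S.strata), ∀ x ∈ (τ X).T, g • x ∈ (τ X).T ∧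
      ∀ s : ℝ, 0 ≤ s → (τ X).m s (g • x) = g • (τ X).m s x := fun g X x hx =>
    (τ X).map_m (h.adjusted.isOpen_upper _) (hsmooth g) (hS X X.2 g) (hG.vectorField X g) hx
  have hT : ∀ (g : G) (d : ℕ) (x : M), g • x ∈ τ.tubes d ↔ x ∈ τ.tubes d := by
    have himp : ∀ (g : G) (d : ℕ) (x : M), x ∈ τ.tubes d → g • x ∈ τ.tubes d :=
      fun g d x ⟨X, hX, hx⟩ => ⟨X, hX, (hm g X x hx).1⟩
    exact fun g d x => ⟨fun hx => by simpa using himp g⁻¹ d _ hx, himp g d x⟩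
  have hdist : ∀ d x, x ∈ τ.tubes d → τ.dist d (g • x) = τ.dist d x := by
    rintro _ x ⟨X, rfl, hx⟩
    rw [h.adjusted.dist_eq hx, h.adjusted.dist_eq (hm g X x hx).1, hG.distance X g x hx]
  have hcut : ∀ d x, τ.cutoff d (g • x) = τ.cutoff d x := by
    intro d x
    by_cases hx : x ∈ τ.tubes d
    · rw [cutoff, cutoff, if_pos hx, if_pos ((hT g d x).2 hx), hdist d x hx]
    · rw [cutoff, cutoff, if_neg hx, if_neg (mt (hT g d x).1 hx)]
  have hweight : ∀ d x, τ.weight d (g • x) = τ.weight d x := by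
    intro d x
    by_cases hx : x ∈ τ.tubes d
    · simp only [weight, if_pos hx, if_pos ((hT g d x).2 hx), hdist d x hx, hcut]
    · rw [weight, weight, if_neg hx, if_neg (mt (hT g d x).1 hx)]
  have hmul : ∀ d x s, 0 ≤ s → τ.mul d s (g • x) = g • τ.mul d s x := by
    intro d x s hs
    by_cases hx : x ∈ τ.tubes d
    · obtain ⟨X, rfl, hx⟩ := hx
      rw [h.adjusted.mul_eq hx, h.adjusted.mul_eq (hm g X x hx).1, (hm g X x hx).2 s hs]
    · rw [mul_of_notMem hx, mul_of_notMem (mt (hT g d x).1 hx)]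
  induction k generalizing x with
  | zero => rfl
  | succ k ih =>
    have hstep : τ.step k (g • x, t) = g • τ.step k (x, t) := by
      simp only [step, hweight]
      exact hmul k x _ (scalar_mem_Icc (τ := τ) k (x, t)).1
    simp only [homotopy, hstep, ih]

end IsCommutativeTangentialControlData

end TubeCollection

end Retraction

end StratControl

end

theorem mainTheorem5 {n : ℕ} {M : Type u} [TopologicalSpace M] [T2Space M]
    [SecondCountableTopology M] [ChartedSpace (EuclideanSpace ℝ (Fin n)) M]
    [IsManifold (𝓡 n) ∞ M]
    (S : StratControl.StratifiedSubset n M) (τ : StratControl.TubeCollection S)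
    (hτ : τ.IsCommutativeTangentialControlData) :
    (∃ F : M × unitInterval → M,
      StratControl.RestrictsToWeakDeformationRetraction (n := n) F τ.neighbourhood S.carrier) ∧
    (∀ (k : ℕ) (G : Type w) [Group G] [TopologicalSpace G] [T2Space G] [CompactSpace G]
      [ChartedSpace (EuclideanSpace ℝ (Fin k)) G] [LieGroup (𝓡 k) ∞ G] [MulAction G M],
      ContMDiff ((𝓡 k).prod (𝓡 n)) (𝓡 n) ∞ (fun q : G × M => q.1 • q.2) →
      StratControl.IsGStratification G S → τ.IsEquivariant G →
      ∃ F : M × unitInterval → M,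
        StratControl.RestrictsToWeakDeformationRetraction (n := n) F τ.neighbourhood S.carrier ∧
        ∀ (g : G) (x : M) (t : unitInterval), F (g • x, t) = g • F (x, t)) := by
  refine ⟨⟨_, hτ.restrictsToWeakDeformationRetraction⟩, ?_⟩
  intro k G _ _ _ _ _ _ _ hsmooth hS hG
  exact ⟨_, hτ.restrictsToWeakDeformationRetraction, hτ.homotopy_smul
    (fun g => hsmooth.comp (contMDiff_const.prodMk contMDiff_id)) hS hG _⟩
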